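/- **Setting.** Formulas are built from denumerably many atoms $p$ by $\neg\phi$, $\Box\phi$, $\phi\land\psi$, $\phi\lor\psi$. A *sequent* $\Gamma\Rightarrow\Delta$ is an ordered pair of finite sets of formulas ($\Gamma,\phi$ and $\phi,\Gamma$ both mean $\Gamma\cup\{\phi\}$; an empty side is left blank). A *hypersequent* $S_1/\!/\cdots/\!/S_n$ is a finite list of sequents. A *Kripke model* consists of a set $W$ of points, a relation $R\subseteq W\times W$, and a valuation of formulas at points that is arbitrary on atoms, Boolean at each point for $\neg,\land,\lor$, and satisfies: $\Box\phi$ is true at $x$ iff $\phi$ is true at every $y$ with $xRy$. It is a *countermodel* to $S_1/\!/\cdots/\!/S_n$ with $S_i=(\Gamma_i\Rightarrow\Delta_i)$ if there are points $w_1,\dots,w_n$ with $w_iRw_{i+1}$ for $1\le i<n$ such that, for each $i$, every formula in $\Gamma_i$ is true at $w_i$ and every formula in $\Delta_i$ is false at $w_i$. We write $\vDash_{\mathbf{S4}}H$ if no model whose relation $R$ is reflexive and transitive is a countermodel to $H$. The calculus $\mathrm{RS4_{Cut}}$ has the following rules, written (premises) $\leadsto$ (conclusion), where $G,H$ are arbitrary,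 possibly empty, lists of sequents: - $\mathrm{Id}$: $p\Rightarrow p$ is an axiom for every atom $p$. - $\mathrm{Cut}$: $G/\!/\Gamma\Rightarrow\phi,\Delta/\!/H$ and $G/\!/\Gamma,\phi\Rightarrow\Delta/\!/H$ $\leadsto$ $G/\!/\Gamma\Rightarrow\Delta/\!/H$. - $EW\mathrm L$: $G\leadsto{}\Rightarrow/\!/G$. $EW\mathrm R$: $G\leadsto G/\!/\Rightarrow$. $EW$: $G/\!/H\leadsto G/\!/\Rightarrow/\!/H$. - $EC$: $G/\!/\Gamma\Rightarrow\Delta/\!/\Gamma\Rightarrow\Delta/\!/H\leadsto G/\!/\Gamma\Rightarrow\Delta/\!/H$. - $T\mathrm L$, $T\mathrm R$: $G/\!/\Gamma\Rightarrow\Delta/\!/H\leadsto G/\!/\Gamma,\phi\Rightarrow\Delta/\!/H$, and $\leadsto G/\!/\Gamma\Rightarrow\phi,\Delta/\!/H$. - $\Box\mathrm R$: $G/\!/\Gamma\Rightarrow\Delta/\!/\Rightarrow\phi\leadsto G/\!/\Gamma\Rightarrow\Box\phi,\Delta$. - $\Box\mathrm L$: $G/\!/\Gamma\Rightarrow\Delta/\!/\Sigma,\phi\Rightarrow\Lambda/\!/H\leadsto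 G/\!/\Gamma,\Box\phi\Rightarrow\Delta/\!/\Sigma\Rightarrow\Lambda/\!/H$. - $\neg\mathrm L$: $G/\!/\Gamma\Rightarrow\Delta,\phi/\!/H\leadsto G/\!/\Gamma,\neg\phi\Rightarrow\Delta/\!/H$. $\neg\mathrm R$: $G/\!/\Gamma,\phi\Rightarrow\Delta/\!/H\leadsto G/\!/\Gamma\Rightarrow\neg\phi,\Delta/\!/H$. - $\land\mathrm L_1$, $\land\mathrm L_2$: $G/\!/\Gamma,\chi\Rightarrow\Delta/\!/H\leadsto G/\!/\Gamma,\phi\land\psi\Rightarrow\Delta/\!/H$ for $\chi=\phi$, respectively $\chi=\psi$. $\land\mathrm R$: $G/\!/\Gamma\Rightarrow\phi,\Delta/\!/H$ and $G/\!/\Gamma\Rightarrow\psi,\Delta/\!/H$ $\leadsto$ $G/\!/\Gamma\Rightarrow\phi\land\psi,\Delta/\!/H$. - $\lor\mathrm L$: $G/\!/\Gamma,\phi\Rightarrow\Delta/\!/H$ and $G/\!/\Gamma,\psi\Rightarrow\Delta/\!/H$ $\leadsto$ $G/\!/\Gamma,\phi\lor\psi\Rightarrow\Delta/\!/H$. $\lor\mathrm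 R_1$, $\lor\mathrm R_2$: $G/\!/\Gamma\Rightarrow\Delta,\chi/\!/H\leadsto G/\!/\Gamma\Rightarrow\phi\lor\psi,\Delta/\!/H$ for $\chi=\phi$, respectively $\chi=\psi$. We write $\vdash_{\mathrm{RS4_{Cut}}}H$ if $H$ is the root of a finite derivation tree built from these rules with all leaves instances of $\mathrm{Id}$. **Theorem.** $\mathrm{RS4}$ with $\mathrm{Cut}$ as a primitive rule is hypersequent complete for S4 frames: for every hypersequent $H$, if $\vDash_{\mathbf{S4}}H$ then $\vdash_{\mathrm{RS4_{Cut}}}H$. -/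

import Mathlib

universe u

namespace RelHyp

/-- Formulas of the modal language: denumerably many atoms (indexed by `ℕ`), `¬`, `□`, `∧`, `∨`. -/
inductive Formula : Type where
  | atom (p : ℕ)
  | neg (φ : Formula)
  | box (φ : Formula)
  | and (φ ψ : Formula)
  | or (φ ψ : Formula)
  deriving DecidableEq

/-- A sequent `Γ ⇒ Δ`: an ordered pair of finite sets of formulas. -/
structure Sequent : Type where
  left : Finset Formula
  right : Finset Formula

infix:55 " ⇒ₛ " => Sequent.mk

/-- A hypersequent `S₁ // ⋯ // Sₙ`: a finite list of sequents. -/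
abbrev Hypersequent : Type := List Sequent

/-- A Kripke model: points, an accessibility relation, and a valuation of the atoms at points. -/
structure Model : Type (u + 1) where
  W : Type u
  R : W → W → Prop
  V : ℕ → W → Prop

/-- `M.Sat φ x`: the formula `φ` has value `1` at the point `x` of `M`. -/
def Model.Sat (M : Model.{u}) : Formula → M.W → Prop
  | .atom p, x => M.V p x
  | .neg φ, x => ¬ M.Sat φ x
  | .box φ, x => ∀ y, M.R x y → M.Sat φ y
  | .and φ ψ, x => M.Sat φ x ∧ M.Sat ψ x
  | .or φ ψ, x => M.Sat φ x ∨ M.Sat ψ x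

/-- `M` is a countermodel to the sequent `S` at the point `w`. -/
def Model.CounterSequent (M : Model.{u}) (S : Sequent) (w : M.W) : Prop :=
  (∀ φ ∈ S.left, M.Sat φ w) ∧ (∀ ψ ∈ S.right, ¬ M.Sat ψ w)

/-- `M` is a countermodel to the hypersequent `S₁ // ⋯ // Sₙ`: some branch `w₁ R w₂ R ⋯ R wₙ`
refutes each `Sᵢ` at `wᵢ`. -/
def Model.Counter (M : Model.{u}) (H : Hypersequent) : Prop :=
  ∃ ws : List M.W, ws.IsChain M.R ∧ List.Forall₂ M.CounterSequent H ws

/-- `H` is valid in the class of S4 frames: no model on a reflexive transitive frame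
is a countermodel to `H`. -/
def ValidS4 (H : Hypersequent) : Prop :=
  ∀ M : Model.{u}, (∀ x, M.R x x) → (∀ x y z, M.R x y → M.R y z → M.R x z) → ¬ M.Counter H

/-- Derivability in `RS4` with `Cut` as a basic rule. Here `Γ, φ` is `insert φ Γ`, and the
side hypersequents `G` and `H` may be empty. -/
inductive RS4Cut : Hypersequent → Prop
  | id (p : ℕ) : RS4Cut [{.atom p} ⇒ₛ {.atom p}]
  | cut (G H : Hypersequent) (Γ Δ : Finset Formula) (φ : Formula) :
      RS4Cut (G ++ [Γ ⇒ₛ insert φ Δ] ++ H) → RS4Cut (G ++ [insert φ Γ ⇒ₛ Δ] ++ H) →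
      RS4Cut (G ++ [Γ ⇒ₛ Δ] ++ H)
  -- external weakening on the left end, on the right end, and anywhere
  | ewL (G : Hypersequent) : RS4Cut G → RS4Cut ([∅ ⇒ₛ ∅] ++ G)
  | ewR (G : Hypersequent) : RS4Cut G → RS4Cut (G ++ [∅ ⇒ₛ ∅])
  | ew (G H : Hypersequent) : RS4Cut (G ++ H) → RS4Cut (G ++ [∅ ⇒ₛ ∅] ++ H)
  -- external contraction
  | ec (G H : Hypersequent) (Γ Δ : Finset Formula) :
      RS4Cut (G ++ [Γ ⇒ₛ Δ, Γ ⇒ₛ Δ] ++ H) → RS4Cut (G ++ [Γ ⇒ₛ Δ] ++ H)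
  -- internal weakening
  | tL (G H : Hypersequent) (Γ Δ : Finset Formula) (φ : Formula) :
      RS4Cut (G ++ [Γ ⇒ₛ Δ] ++ H) → RS4Cut (G ++ [insert φ Γ ⇒ₛ Δ] ++ H)
  | tR (G H : Hypersequent) (Γ Δ : Finset Formula) (φ : Formula) :
      RS4Cut (G ++ [Γ ⇒ₛ Δ] ++ H) → RS4Cut (G ++ [Γ ⇒ₛ insert φ Δ] ++ H)
  -- modal rules
  | boxR (G : Hypersequent) (Γ Δ : Finset Formula) (φ : Formula) :
      RS4Cut (G ++ [Γ ⇒ₛ Δ, ∅ ⇒ₛ {φ}]) → RS4Cut (G ++ [Γ ⇒ₛ insert (.box φ) Δ])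
  | boxL (G H : Hypersequent) (Γ Δ Θ Λ : Finset Formula) (φ : Formula) :
      RS4Cut (G ++ [Γ ⇒ₛ Δ, insert φ Θ ⇒ₛ Λ] ++ H) →
      RS4Cut (G ++ [insert (.box φ) Γ ⇒ₛ Δ, Θ ⇒ₛ Λ] ++ H)
  -- propositional rules
  | negL (G H : Hypersequent) (Γ Δ : Finset Formula) (φ : Formula) :
      RS4Cut (G ++ [Γ ⇒ₛ insert φ Δ] ++ H) → RS4Cut (G ++ [insert (.neg φ) Γ ⇒ₛ Δ] ++ H)
  | negR (G H : Hypersequent) (Γ Δ : Finset Formula) (φ : Formula) :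
      RS4Cut (G ++ [insert φ Γ ⇒ₛ Δ] ++ H) → RS4Cut (G ++ [Γ ⇒ₛ insert (.neg φ) Δ] ++ H)
  | andL₁ (G H : Hypersequent) (Γ Δ : Finset Formula) (φ ψ : Formula) :
      RS4Cut (G ++ [insert φ Γ ⇒ₛ Δ] ++ H) → RS4Cut (G ++ [insert (.and φ ψ) Γ ⇒ₛ Δ] ++ H)
  | andL₂ (G H : Hypersequent) (Γ Δ : Finset Formula) (φ ψ : Formula) :
      RS4Cut (G ++ [insert ψ Γ ⇒ₛ Δ] ++ H) → RS4Cut (G ++ [insert (.and φ ψ) Γ ⇒ₛ Δ] ++ H)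
  | andR (G H : Hypersequent) (Γ Δ : Finset Formula) (φ ψ : Formula) :
      RS4Cut (G ++ [Γ ⇒ₛ insert φ Δ] ++ H) → RS4Cut (G ++ [Γ ⇒ₛ insert ψ Δ] ++ H) →
      RS4Cut (G ++ [Γ ⇒ₛ insert (.and φ ψ) Δ] ++ H)
  | orL (G H : Hypersequent) (Γ Δ : Finset Formula) (φ ψ : Formula) :
      RS4Cut (G ++ [insert φ Γ ⇒ₛ Δ] ++ H) → RS4Cut (G ++ [insert ψ Γ ⇒ₛ Δ] ++ H) →
      RS4Cut (G ++ [insert (.or φ ψ) Γ ⇒ₛ Δ] ++ H)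
  | orR₁ (G H : Hypersequent) (Γ Δ : Finset Formula) (φ ψ : Formula) :
      RS4Cut (G ++ [Γ ⇒ₛ insert φ Δ] ++ H) → RS4Cut (G ++ [Γ ⇒ₛ insert (.or φ ψ) Δ] ++ H)
  | orR₂ (G H : Hypersequent) (Γ Δ : Finset Formula) (φ ψ : Formula) :
      RS4Cut (G ++ [Γ ⇒ₛ insert ψ Δ] ++ H) → RS4Cut (G ++ [Γ ⇒ₛ insert (.or φ ψ) Δ] ++ H)

end RelHyp

/-!
The proof reduces hypersequents to single sequents and uses a canonical model for the latter.

Call a set of formulas consistent if no sequent `Γ ⇒ ∅` with `Γ` a finite part of it is derivable.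
Because of `Cut`, a maximal consistent set is closed under derivable single sequents, so it
respects the Boolean connectives. Take the maximal consistent sets as points, with `A R B` iff
`φ ∈ B` whenever `□φ ∈ A`. External contraction makes `R` reflexive (`□φ ⇒ φ` is derivable) and
weakening by an empty sequent between two others makes it transitive (`□φ ⇒ □□φ` is derivable).
The rules `□L` and `□R` together give necessitation, from `Γ ⇒ φ` to `□Γ ⇒ □φ`
(`RS4Cut.box_image`), which supplies the successor refuting `φ` when `□φ ∉ A`. Hence every valid
single sequent is derivable (`RS4Cut.of_forall_not_counterSequent`).

For the passage to hypersequents, each hypersequent `T` is assigned a formula `χ` that is true at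
`x` iff no branch that continues from `x` refutes `T`; for `T = S // T'` this is `□θ`, where `θ`
says that the point does not refute `S` or satisfies the formula of `T'`. If `G // Γ ⇒ χ, Δ` is
derivable then so is `G // Γ ⇒ Δ // T` (`exists_formula_forall_append`): cutting `□θ` against
`□θ ⇒ // ⇒ θ` moves `θ` into a new last sequent, and there `θ` is cut against `θ, Γ' ⇒ χ', Δ'`,
where `S = (Γ' ⇒ Δ')` and `χ'` is the formula of `T'`; this sequent is valid and hence derivable
by the case of single sequents. A valid hypersequent `Γ ⇒ Δ // T` thus follows from the valid
sequent `Γ ⇒ χ, Δ`.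
-/

namespace RelHyp

/-! ### Derived rules -/

theorem RS4Cut.weaken {G H : Hypersequent} {Γ Δ Γ' Δ' : Finset Formula}
    (h : RS4Cut (G ++ [Γ ⇒ₛ Δ] ++ H)) (hΓ : Γ ⊆ Γ') (hΔ : Δ ⊆ Δ') :
    RS4Cut (G ++ [Γ' ⇒ₛ Δ'] ++ H) := by
  have left : ∀ Ξ : Finset Formula, RS4Cut (G ++ [Ξ ∪ Γ ⇒ₛ Δ] ++ H) := by
    intro Ξ
    induction Ξ using Finset.induction_on with
    | empty => simpa using h
    | insert φ s _ ih => rw [Finset.insert_union]; exact .tL _ _ _ _ _ ih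
  have right : ∀ Λ : Finset Formula, RS4Cut (G ++ [Γ' ⇒ₛ Λ ∪ Δ] ++ H) := by
    intro Λ
    induction Λ using Finset.induction_on with
    | empty => simpa [Finset.union_eq_left.2 hΓ] using left Γ'
    | insert φ s _ ih => rw [Finset.insert_union]; exact .tR _ _ _ _ _ ih
  simpa [Finset.union_eq_left.2 hΔ] using right Δ'

theorem RS4Cut.prepend {K : Hypersequent} (h : RS4Cut K) (G : Hypersequent) :
    RS4Cut (G ++ K) := by
  induction G with
  | nil => exact h
  | cons S G ih =>
    exact RS4Cut.weaken (G := []) (RS4Cut.ewL _ ih)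
      (Finset.empty_subset S.left) (Finset.empty_subset S.right)

theorem RS4Cut.append {K : Hypersequent} (h : RS4Cut K) (H : Hypersequent) :
    RS4Cut (K ++ H) := by
  induction H generalizing K with
  | nil => simpa using h
  | cons S H ih =>
    have h' : RS4Cut (K ++ [S] ++ []) :=
      RS4Cut.weaken (by simpa using RS4Cut.ewR _ h)
        (Finset.empty_subset S.left) (Finset.empty_subset S.right)
    simpa using ih h'

/-- A single sequent derivation can be placed in any hypersequent context. -/
theorem RS4Cut.lift {S : Sequent} (h : RS4Cut [S]) (G H : Hypersequent) :
    RS4Cut (G ++ [S] ++ H) :=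
  (h.prepend G).append H

theorem RS4Cut.mono {Γ Δ Γ' Δ' : Finset Formula} (h : RS4Cut [Γ ⇒ₛ Δ])
    (hΓ : Γ ⊆ Γ') (hΔ : Δ ⊆ Δ') : RS4Cut [Γ' ⇒ₛ Δ'] :=
  RS4Cut.weaken (G := []) (H := []) h hΓ hΔ

/-- `□φ ⇒ // ⇒ φ` follows from `φ ⇒ φ`. -/
theorem RS4Cut.box_step {φ : Formula} (h : RS4Cut [{φ} ⇒ₛ {φ}]) :
    RS4Cut [{φ.box} ⇒ₛ ∅, ∅ ⇒ₛ {φ}] :=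
  RS4Cut.boxL [] [] ∅ ∅ ∅ {φ} φ (RS4Cut.ewL _ h)

theorem RS4Cut.refl (φ : Formula) : RS4Cut [{φ} ⇒ₛ {φ}] := by
  induction φ with
  | atom p => exact .id p
  | neg φ ih =>
    exact RS4Cut.negR [] [] {φ.neg} ∅ φ (by
      rw [Finset.pair_comm]
      exact RS4Cut.negL [] [] {φ} ∅ φ ih)
  | box φ ih => exact RS4Cut.boxR [] {φ.box} ∅ φ ih.box_step
  | and φ ψ ihφ ihψ =>
    exact RS4Cut.andR [] [] _ ∅ φ ψ (RS4Cut.andL₁ [] [] ∅ {φ} φ ψ ihφ)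
      (RS4Cut.andL₂ [] [] ∅ {ψ} φ ψ ihψ)
  | or φ ψ ihφ ihψ =>
    exact RS4Cut.orL [] [] ∅ _ φ ψ (RS4Cut.orR₁ [] [] {φ} ∅ φ ψ ihφ)
      (RS4Cut.orR₂ [] [] {ψ} ∅ φ ψ ihψ)

theorem RS4Cut.of_mem {Γ Δ : Finset Formula} {φ : Formula} (hΓ : φ ∈ Γ) (hΔ : φ ∈ Δ) :
    RS4Cut [Γ ⇒ₛ Δ] :=
  (RS4Cut.refl φ).mono (by simpa using hΓ) (by simpa using hΔ)

/-- The formulas of the left side `Ξ` are cut one after the other. -/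
theorem RS4Cut.multicut {Ξ Γ Δ : Finset Formula} (h : RS4Cut [Ξ ⇒ₛ Δ])
    (hc : ∀ φ ∈ Ξ, RS4Cut [Γ ⇒ₛ insert φ Δ]) : RS4Cut [Γ ⇒ₛ Δ] := by
  replace h : RS4Cut [Ξ ∪ Γ ⇒ₛ Δ] := h.mono Finset.subset_union_left subset_rfl
  induction Ξ using Finset.induction_on with
  | empty => simpa using h
  | insert φ s _ ih =>
    refine ih (fun ψ hψ => hc ψ (Finset.mem_insert_of_mem hψ)) ?_
    rw [Finset.insert_union] at h
    exact RS4Cut.cut [] [] _ _ φ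
      ((hc φ (Finset.mem_insert_self _ _)).mono Finset.subset_union_right subset_rfl) h

/-- Axiom `T`: both sequents of `□φ ⇒ // ⇒ φ` are weakened to `□φ ⇒ φ` and then contracted. -/
theorem RS4Cut.box_refl (φ : Formula) : RS4Cut [{φ.box} ⇒ₛ {φ}] := by
  have h := (RS4Cut.refl φ).box_step
  have h₁ : RS4Cut [{φ.box} ⇒ₛ {φ}, ∅ ⇒ₛ {φ}] :=
    RS4Cut.weaken (G := []) h subset_rfl (Finset.empty_subset _)
  exact RS4Cut.ec [] [] _ _
    (RS4Cut.weaken (G := [{φ.box} ⇒ₛ {φ}]) (H := []) h₁ (Finset.empty_subset _) subset_rfl)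

/-- Axiom `4`: an empty sequent is inserted between those of `□φ ⇒ // ⇒ φ`, and `□R` is then
applied twice. -/
theorem RS4Cut.box_trans (φ : Formula) : RS4Cut [{φ.box} ⇒ₛ {φ.box.box}] :=
  RS4Cut.boxR [] _ ∅ _ <| RS4Cut.boxR [{φ.box} ⇒ₛ ∅] ∅ ∅ φ <|
    RS4Cut.ew [{φ.box} ⇒ₛ ∅] [∅ ⇒ₛ {φ}] (RS4Cut.refl φ).box_step

/-- Necessitation: boxing every formula of `Γ ⇒ φ` preserves derivability. -/
theorem RS4Cut.box_image {Γ : Finset Formula} {φ : Formula} (h : RS4Cut [Γ ⇒ₛ {φ}]) :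
    RS4Cut [Γ.image .box ⇒ₛ {φ.box}] := by
  have key : ∀ Ξ : Finset Formula, ∀ Θ, RS4Cut [∅ ⇒ₛ ∅, Ξ ∪ Θ ⇒ₛ {φ}] →
      RS4Cut [Ξ.image .box ⇒ₛ ∅, Θ ⇒ₛ {φ}] := by
    intro Ξ
    induction Ξ using Finset.induction_on with
    | empty => intro Θ h; simpa using h
    | insert ψ s _ ih =>
      intro Θ h
      rw [Finset.image_insert]
      refine RS4Cut.boxL [] [] _ ∅ Θ {φ} ψ (ih _ ?_)
      rwa [Finset.union_insert, ← Finset.insert_union]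
  exact RS4Cut.boxR [] _ ∅ φ (key Γ ∅ (by simpa using RS4Cut.ewL _ h))

/-! ### Maximal consistent sets -/

/-- A set of formulas is consistent if no finite part of it is refutable as the left side of a
single sequent with empty right side. -/
def Consistent (A : Set Formula) : Prop :=
  ∀ Γ : Finset Formula, (Γ : Set Formula) ⊆ A → ¬ RS4Cut [Γ ⇒ₛ ∅]

theorem Consistent.exists_maximal {A : Set Formula} (hA : Consistent A) :
    ∃ B, A ⊆ B ∧ Maximal Consistent B := by
  -- Consistency is of finite character, hence preserved by unions of chains.
  refine zorn_subset_nonempty {B | Consistent B} (fun c hc hchain hne => ?_) A hA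
  refine ⟨⋃₀ c, fun Γ hΓ => ?_, fun s hs => Set.subset_sUnion_of_mem hs⟩
  obtain ⟨B, hB, hΓB⟩ :=
    hchain.directedOn.exists_mem_subset_of_finset_subset_biUnion hne
      (by simpa [Set.sUnion_eq_biUnion] using hΓ)
  exact hc hB Γ hΓB

section Maximal

variable {A : Set Formula}

theorem exists_of_notMem {φ : Formula} (hA : Maximal Consistent A) (hφ : φ ∉ A) :
    ∃ Γ : Finset Formula, (Γ : Set Formula) ⊆ A ∧ RS4Cut [insert φ Γ ⇒ₛ ∅] := by
  have h : ¬ Consistent (insert φ A) := fun h =>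
    hφ (hA.2 h (Set.subset_insert φ A) (Set.mem_insert φ A))
  simp only [Consistent, not_forall, not_not] at h
  obtain ⟨Γ, hΓ, hd⟩ := h
  exact ⟨Γ.erase φ, by simpa [Set.sdiff_subset_iff] using hΓ,
    hd.mono (Finset.insert_erase_subset φ Γ) subset_rfl⟩

/-- A maximal consistent set is deductively closed. -/
theorem mem_of_derivable {φ : Formula} {Γ : Finset Formula} (hA : Maximal Consistent A)
    (hΓ : (Γ : Set Formula) ⊆ A) (h : RS4Cut [Γ ⇒ₛ {φ}]) : φ ∈ A := by
  by_contra hφ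
  obtain ⟨Γ', hΓ', hd⟩ := exists_of_notMem hA hφ
  refine hA.1 (Γ ∪ Γ') (by simpa using ⟨hΓ, hΓ'⟩) ?_
  exact RS4Cut.cut [] [] _ _ φ (h.mono Finset.subset_union_left subset_rfl)
    (hd.mono (Finset.insert_subset_insert _ Finset.subset_union_right) subset_rfl)

theorem mem_of_derivable_singleton {φ ψ : Formula} (hA : Maximal Consistent A) (hψ : ψ ∈ A)
    (h : RS4Cut [{ψ} ⇒ₛ {φ}]) : φ ∈ A :=
  mem_of_derivable hA (by simpa using hψ) h

theorem neg_mem_iff {φ : Formula} (hA : Maximal Consistent A) : φ.neg ∈ A ↔ φ ∉ A := by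
  refine ⟨fun hn hφ => ?_, fun hφ => ?_⟩
  · exact hA.1 {φ.neg, φ} (by simp [Set.insert_subset_iff, hn, hφ])
      (RS4Cut.negL [] [] {φ} ∅ φ (RS4Cut.refl φ))
  · obtain ⟨Γ, hΓ, hd⟩ := exists_of_notMem hA hφ
    exact mem_of_derivable hA hΓ (RS4Cut.negR [] [] Γ ∅ φ hd)

theorem and_mem_iff {φ ψ : Formula} (hA : Maximal Consistent A) :
    φ.and ψ ∈ A ↔ φ ∈ A ∧ ψ ∈ A := by
  refine ⟨fun h => ⟨?_, ?_⟩, fun ⟨h₁, h₂⟩ => ?_⟩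
  · exact mem_of_derivable_singleton hA h (RS4Cut.andL₁ [] [] ∅ {φ} φ ψ (RS4Cut.refl φ))
  · exact mem_of_derivable_singleton hA h (RS4Cut.andL₂ [] [] ∅ {ψ} φ ψ (RS4Cut.refl ψ))
  · refine mem_of_derivable (Γ := {φ, ψ}) hA (by simp [Set.insert_subset_iff, h₁, h₂]) ?_
    exact RS4Cut.andR [] [] _ ∅ φ ψ (RS4Cut.of_mem (φ := φ) (by simp) (by simp))
      (RS4Cut.of_mem (φ := ψ) (by simp) (by simp))

theorem or_mem_iff {φ ψ : Formula} (hA : Maximal Consistent A) :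
    φ.or ψ ∈ A ↔ φ ∈ A ∨ ψ ∈ A := by
  refine ⟨fun h => ?_, ?_⟩
  · by_contra! hn
    obtain ⟨h₁, h₂⟩ := hn
    rw [← neg_mem_iff hA] at h₁ h₂
    refine hA.1 {φ.or ψ, φ.neg, ψ.neg} (by simp [Set.insert_subset_iff, h, h₁, h₂]) ?_
    refine RS4Cut.orL [] [] _ ∅ φ ψ ?_ ?_
    · rw [Finset.insert_comm]
      exact RS4Cut.negL [] [] _ ∅ φ (RS4Cut.of_mem (φ := φ) (by simp) (by simp))
    · rw [Finset.pair_comm φ.neg, Finset.insert_comm]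
      exact RS4Cut.negL [] [] _ ∅ ψ (RS4Cut.of_mem (φ := ψ) (by simp) (by simp))
  · rintro (h | h)
    · exact mem_of_derivable_singleton hA h (RS4Cut.orR₁ [] [] {φ} ∅ φ ψ (RS4Cut.refl φ))
    · exact mem_of_derivable_singleton hA h (RS4Cut.orR₂ [] [] {ψ} ∅ φ ψ (RS4Cut.refl ψ))

/-- A set `A` without `□φ` has a successor in the canonical model without `φ`: by necessitation
the formulas `ψ` with `□ψ ∈ A` are consistent with `¬φ`. -/
theorem exists_successor {φ : Formula} (hA : Maximal Consistent A) (hφ : φ.box ∉ A) :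
    ∃ B, Maximal Consistent B ∧ (∀ ψ : Formula, ψ.box ∈ A → ψ ∈ B) ∧ φ ∉ B := by
  have hc : Consistent (insert φ.neg {ψ | ψ.box ∈ A}) := by
    intro Γ hΓ hd
    have hd' : RS4Cut [Γ.erase φ.neg ⇒ₛ {φ}] := by
      refine (hd.mono subset_rfl (Finset.empty_subset _)).multicut fun ψ hψ => ?_
      by_cases h : ψ = φ.neg
      · subst h
        exact RS4Cut.negR [] [] _ _ φ (RS4Cut.of_mem (φ := φ) (by simp) (by simp))
      · exact RS4Cut.of_mem (φ := ψ) (by simp [h, hψ]) (by simp)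
    refine hφ (mem_of_derivable hA ?_ hd'.box_image)
    intro χ hχ
    simp only [Finset.coe_image, Finset.coe_erase, Set.mem_image] at hχ
    obtain ⟨ψ, ⟨hψ, hne⟩, rfl⟩ := hχ
    exact (hΓ hψ).resolve_left hne
  obtain ⟨B, hsub, hB⟩ := hc.exists_maximal
  exact ⟨B, hB, fun ψ hψ => hsub (Or.inr hψ), (neg_mem_iff hB).1 (hsub (Or.inl rfl))⟩

end Maximal

/-! ### The canonical model and single sequents -/

/-- The canonical model: its points are the maximal consistent sets, `A` sees `B` if `φ ∈ B`
whenever `□φ ∈ A`, and an atom is true at the sets that contain it. The points are lifted to an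
arbitrary universe. -/
def canonicalModel : Model.{u} where
  W := ULift.{u} {A : Set Formula // Maximal Consistent A}
  R A B := ∀ φ : Formula, φ.box ∈ A.down.1 → φ ∈ B.down.1
  V p A := Formula.atom p ∈ A.down.1

theorem canonicalModel_refl (A : canonicalModel.{u}.W) : canonicalModel.R A A := fun φ h =>
  mem_of_derivable_singleton A.down.2 h (RS4Cut.box_refl φ)

theorem canonicalModel_trans (A B C : canonicalModel.{u}.W) (hAB : canonicalModel.R A B)
    (hBC : canonicalModel.R B C) : canonicalModel.R A C := fun φ h =>
  hBC φ (hAB φ.box (mem_of_derivable_singleton A.down.2 h (RS4Cut.box_trans φ)))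

/-- The truth lemma. -/
theorem canonicalModel_sat_iff (φ : Formula) (A : canonicalModel.{u}.W) :
    canonicalModel.Sat φ A ↔ φ ∈ A.down.1 := by
  induction φ generalizing A with
  | atom p => exact Iff.rfl
  | neg φ ih => exact (not_congr (ih A)).trans (neg_mem_iff A.down.2).symm
  | and φ ψ ihφ ihψ => exact (and_congr (ihφ A) (ihψ A)).trans (and_mem_iff A.down.2).symm
  | or φ ψ ihφ ihψ => exact (or_congr (ihφ A) (ihψ A)).trans (or_mem_iff A.down.2).symm
  | box φ ih =>
    refine ⟨fun h => ?_, fun h B hAB => (ih B).2 (hAB φ h)⟩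
    by_contra hφ
    obtain ⟨B, hB, hAB, hφB⟩ := exists_successor A.down.2 hφ
    exact hφB ((ih ⟨B, hB⟩).1 (h ⟨B, hB⟩ hAB))

/-- Completeness for single sequents. -/
theorem RS4Cut.of_forall_not_counterSequent {S : Sequent}
    (h : ∀ M : Model.{u}, (∀ x, M.R x x) → (∀ x y z, M.R x y → M.R y z → M.R x z) →
      ∀ x, ¬ M.CounterSequent S x) : RS4Cut [S] := by
  by_contra hS
  have hc : Consistent (S.left ∪ Formula.neg '' S.right) := by
    intro Γ hΓ hd
    refine hS ((hd.mono subset_rfl (Finset.empty_subset _)).multicut fun φ hφ => ?_)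
    rcases hΓ hφ with hl | ⟨ψ, hψ, rfl⟩
    · exact RS4Cut.of_mem hl (Finset.mem_insert_self _ _)
    · exact RS4Cut.negR [] [] _ _ ψ (RS4Cut.of_mem (Finset.mem_insert_self _ _) hψ)
  obtain ⟨A, hsub, hA⟩ := hc.exists_maximal
  refine h canonicalModel canonicalModel_refl canonicalModel_trans ⟨A, hA⟩ ⟨?_, ?_⟩
  · exact fun φ hφ => (canonicalModel_sat_iff φ _).2 (hsub (Or.inl hφ))
  · exact fun ψ hψ hs => (neg_mem_iff hA).1 (hsub (Or.inr ⟨ψ, hψ, rfl⟩))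
      ((canonicalModel_sat_iff ψ _).1 hs)

/-! ### Hypersequents -/

theorem exists_formula_bot : ∃ χ : Formula, ∀ (M : Model.{u}) x, ¬ M.Sat χ x :=
  ⟨.and (.atom 0) (.neg (.atom 0)), fun _ _ h => h.2 h.1⟩

/-- The formula is the disjunction of `¬φ` over the left side and of `φ` over the right side. -/
theorem exists_formula_counterSequent (S : Sequent) :
    ∃ χ : Formula, ∀ (M : Model.{u}) x, M.Sat χ x ↔ ¬ M.CounterSequent S x := by
  obtain ⟨bot, hbot⟩ := exists_formula_bot.{u}
  have left : ∀ Γ : Finset Formula,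
      ∃ χ : Formula, ∀ (M : Model.{u}) x, M.Sat χ x ↔ ∃ φ ∈ Γ, ¬ M.Sat φ x := by
    intro Γ
    induction Γ using Finset.induction_on with
    | empty => exact ⟨bot, by simpa using hbot⟩
    | insert φ s _ ih =>
      obtain ⟨χ, hχ⟩ := ih
      exact ⟨.or (.neg φ) χ, by simp [Model.Sat, hχ]⟩
  have right : ∀ Δ : Finset Formula,
      ∃ χ : Formula, ∀ (M : Model.{u}) x, M.Sat χ x ↔ ∃ φ ∈ Δ, M.Sat φ x := by
    intro Δ
    induction Δ using Finset.induction_on with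
    | empty => exact ⟨bot, by simpa using hbot⟩
    | insert φ s _ ih =>
      obtain ⟨χ, hχ⟩ := ih
      exact ⟨.or φ χ, by simp [Model.Sat, hχ]⟩
  obtain ⟨χ, hχ⟩ := left S.left
  obtain ⟨χ', hχ'⟩ := right S.right
  refine ⟨.or χ χ', fun M x => ?_⟩
  simp only [Model.Sat, hχ, hχ', Model.CounterSequent, not_and_or]
  push Not
  rfl

/-- Inversion of the rule `□R`, by a cut. -/
theorem RS4Cut.boxR_inv {G : Hypersequent} {Γ Δ : Finset Formula} {φ : Formula}
    (h : RS4Cut (G ++ [Γ ⇒ₛ insert φ.box Δ])) : RS4Cut (G ++ [Γ ⇒ₛ Δ] ++ [∅ ⇒ₛ {φ}]) := by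
  refine RS4Cut.cut G [∅ ⇒ₛ {φ}] Γ Δ φ.box ?_ ?_
  · have h' := RS4Cut.ewR _ h
    simpa using RS4Cut.weaken (G := G ++ [Γ ⇒ₛ insert φ.box Δ]) (H := []) (by simpa using h')
      (subset_refl (∅ : Finset Formula)) (Finset.empty_subset {φ})
  · have h' : RS4Cut (G ++ [{φ.box} ⇒ₛ ∅] ++ [∅ ⇒ₛ {φ}]) := by
      simpa using (RS4Cut.refl φ).box_step.prepend G
    exact h'.weaken (by simp) (Finset.empty_subset _)

/-- Every hypersequent `T` is expressed by a formula `χ`, in the sense that `χ` is true at `x` iff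
no branch continuing from `x` refutes `T`, and `χ` in the last sequent of a derivable hypersequent
can be traded for the additional sequents `T`. -/
theorem exists_formula_forall_append (T : Hypersequent) :
    ∃ χ : Formula,
      (∀ (M : Model.{u}) x, M.Sat χ x ↔
        ∀ ws : List M.W, (x :: ws).IsChain M.R → ¬ List.Forall₂ M.CounterSequent T ws) ∧
      ∀ (G : Hypersequent) (Γ Δ : Finset Formula),
        RS4Cut (G ++ [Γ ⇒ₛ insert χ Δ]) → RS4Cut (G ++ [Γ ⇒ₛ Δ] ++ T) := by
  induction T with
  | nil =>
    obtain ⟨bot, hbot⟩ := exists_formula_bot.{u}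
    refine ⟨bot, fun M x => ?_, fun G Γ Δ h => ?_⟩
    · simp only [hbot, false_iff, not_forall, not_not]
      exact ⟨[], .singleton x, .nil⟩
    · refine RS4Cut.cut G [] Γ Δ bot (by simpa using h) (RS4Cut.lift ?_ G [])
      exact RS4Cut.of_forall_not_counterSequent.{u} fun M _ _ x hx =>
        hbot M x (hx.1 bot (Finset.mem_insert_self _ _))
  | cons S T ih =>
    obtain ⟨χ, hχ, hder⟩ := ih
    obtain ⟨σ, hσ⟩ := exists_formula_counterSequent.{u} S
    refine ⟨.box (.or σ χ), fun M x => ?_, fun G Γ Δ h => ?_⟩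
    · simp only [Model.Sat, hσ, hχ]
      constructor
      · intro h ws hws hT
        cases hT with
        | cons hS hT =>
          rw [List.isChain_cons_cons] at hws
          exact (h _ hws.1).elim (fun hn => hn hS) fun hn => hn _ hws.2 hT
      · intro h y hxy
        by_contra! hn
        obtain ⟨hS, ws, hws, hT⟩ := hn
        exact h (y :: ws) (List.isChain_cons_cons.2 ⟨hxy, hws⟩) (.cons hS hT)
    · have hlast : RS4Cut (G ++ [Γ ⇒ₛ Δ] ++ [S.left ⇒ₛ insert χ S.right]) := by
        have h₁ : RS4Cut (G ++ [Γ ⇒ₛ Δ] ++ [S.left ⇒ₛ insert (.or σ χ) (insert χ S.right)] ++ []) :=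
          RS4Cut.weaken (by simpa using h.boxR_inv) (Finset.empty_subset _) (by simp)
        have h₂ : RS4Cut [insert (.or σ χ) S.left ⇒ₛ insert χ S.right] := by
          refine RS4Cut.of_forall_not_counterSequent.{u} fun M _ _ x hx => ?_
          refine (hx.1 (.or σ χ) (Finset.mem_insert_self _ _)).elim (fun hs => ?_)
            (hx.2 χ (Finset.mem_insert_self _ _))
          exact (hσ M x).1 hs ⟨fun φ hφ => hx.1 φ (Finset.mem_insert_of_mem hφ),
            fun φ hφ => hx.2 φ (Finset.mem_insert_of_mem hφ)⟩
        simpa using RS4Cut.cut (G ++ [Γ ⇒ₛ Δ]) [] _ _ _ h₁ (h₂.lift _ _)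
      simpa using hder _ _ _ hlast

end RelHyp

theorem mainTheorem6 (H : RelHyp.Hypersequent) (hH : RelHyp.ValidS4.{u} H) :
    RelHyp.RS4Cut H := by
  cases H with
  | nil =>
    -- The empty hypersequent is refuted by the empty branch of any model.
    exact (hH RelHyp.canonicalModel RelHyp.canonicalModel_refl RelHyp.canonicalModel_trans
      ⟨[], .nil, .nil⟩).elim
  | cons S T =>
    obtain ⟨χ, hχ, hder⟩ := RelHyp.exists_formula_forall_append.{u} T
    refine hder [] S.left S.right (RelHyp.RS4Cut.of_forall_not_counterSequent.{u} ?_)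
    intro M hrefl htrans x hx
    refine hx.2 χ (Finset.mem_insert_self _ _) ((hχ M x).2 fun ws hws hT => ?_)
    exact hH M hrefl htrans ⟨x :: ws, hws, .cons
      ⟨hx.1, fun φ hφ => hx.2 φ (Finset.mem_insert_of_mem hφ)⟩ hT⟩
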